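/- **Setting.** For $k\in\mathbb N$ let $k_+=\{0,1,\dots,k\}$, pointed at $0$. An *s-module* (Segal $\Gamma$-set) is a functor $F$ from the category of the pointed sets $k_+$ and pointed maps to pointed sets such that $F(0_+)$ is a point. It is extended to all pointed sets $Y$ by $F(Y)=\operatorname{colim}_{k_+\to Y}F(k_+)$. The s-module $H\mathbb R$ is given by $H\mathbb R(k_+)=\mathbb R^k$ and $(f_*\varphi)_j=\sum_{i\ge 1,\,f(i)=j}\varphi_i$ for $1\le j\le l$ and a pointed map $f\colon k_+\to l_+$; for $\lambda>0$ the sub-s-module $\|H\mathbb R\|_\lambda\subset H\mathbb R$ is $$\|H\mathbb R\|_\lambda(k_+)=\Bigl\{\varphi\in\mathbb R^k \Bigm| \sum_{i=1}^k|\varphi_i|<\lambda\Bigr\}.$$ For a pointed simplicial set $W$ let $\pi_n(W)$ be the set of all $x\in W_n$ all of whose faces are the base point $*$, modulo the equivalence relation generated by: $x\sim y$ if there is $z\in W_{n+1}$ with $\partial_jz=*$ for $j<n$, $\partial_nz=x$ and $\partial_{n+1}z=y$. For a topological space $X$ with singular simplicial set $S(X)$ and an s-module $F$ put $H_n(X;F)=\pi_n(F\circ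 S(X)_+)$, where $S(X)_+$ is $S(X)$ with a disjoint base point added. Since $H\mathbb R(S_n(X)_+)$ is the real vector space $C_n(X;\mathbb R)$ with basis the set $S_n(X)$ of singular $n$-simplices, sending $x$ to the homology class of the corresponding singular cycle gives a map $H_n(X;H\mathbb R)\to H_n(X;\mathbb R)$. The *canonical map* $\rho_{n,\lambda}\colon H_n(X;\|H\mathbb R\|_\lambda)\to H_n(X;\mathbb R)$ is its composition with the map induced by the inclusion $\|H\mathbb R\|_\lambda\subset H\mathbb R$. The *$\ell^1$-semi-norm* of $\alpha\in H_n(X;\mathbb R)$ is $$\|\alpha\|_1=\inf\Bigl\{\sum_{\sigma}|a_\sigma| \Bigm| \sum_\sigma a_\sigma\sigma\in C_n(X;\mathbb R)\text{ is a cycle representing }\alpha\Bigr\},$$ and its *Connes–Consani semi-norm* is $\inf\{\lambda>0\mid \alpha\in\operatorname{im}\rho_{n,\lambda}\}$. **Theorem.** Let $X$ be a topological space, $n\in\mathbb N$ (with $n=0$ allowed) and $\alpha\in H_n(X;\mathbb R)$. Then for every real $\lambda>0$, $$\|\alpha\|_1<\lambda\iff \alpha\in\operatorname{im}\bigl(\rho_{n,\lambda}\colon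 H_n(X;\|H\mathbb R\|_\lambda)\to H_n(X;\mathbb R)\bigr).$$ In particular, the Connes–Consani semi-norm of $\alpha$ equals $\|\alpha\|_1$. -/

import Mathlib

open CategoryTheory Opposite

universe u

/-- The category `Γᵒᵖ`: one object `k₊ = {0, …, k}`, pointed at `0`, for every natural number `k`,
and the base-point preserving maps as morphisms. -/
structure GammaOp : Type where
  card : ℕ

namespace GammaOp

instance : Category GammaOp where
  Hom k l := {f : Fin (k.card + 1) → Fin (l.card + 1) // f 0 = 0}
  id _ := ⟨id, rfl⟩
  comp f g := ⟨g.1 ∘ f.1, by simp [f.2, g.2]⟩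

end GammaOp

/-- An s-module (Segal's Γ-set): a functor from `Γᵒᵖ` to pointed sets sending `0₊` to a point. -/
structure SModule where
  toFunctor : GammaOp ⥤ Pointed.{0}
  subsingleton_zero : Subsingleton (toFunctor.obj ⟨0⟩)

namespace SModule

/-- Representatives of the elements of `F(Y)`, for `Y` an arbitrary pointed set: a pointed map
`k₊ → Y` together with an element of `F(k₊)`. -/
structure Pre (F : SModule) (Y : Pointed.{u}) : Type u where
  k : GammaOp
  pt : Fin (k.card + 1) → Y.X
  pt_zero : pt 0 = Y.point
  coeff : (F.toFunctor.obj k).X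

/-- The relation `(y ∘ f, x) ∼ (y, F(f) x)` for `f : k₊ → l₊`, `y : l₊ → Y` and `x ∈ F(k₊)`. -/
inductive PreRel (F : SModule) (Y : Pointed.{u}) : F.Pre Y → F.Pre Y → Prop
  | mk {k l : GammaOp} (f : k ⟶ l) (y : Fin (l.card + 1) → Y.X) (hy : y 0 = Y.point)
      (x : (F.toFunctor.obj k).X) :
      PreRel F Y ⟨k, y ∘ f.1, by simp [f.2, hy], x⟩ ⟨l, y, hy, (F.toFunctor.map f).toFun x⟩

/-- The value of an s-module on an arbitrary pointed set `Y`: the colimit of the `F(k₊)` over the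
pointed maps `k₊ → Y` (the left Kan extension; equivalently, the filtered colimit over the finite
pointed subsets of `Y`). -/
def extObj (F : SModule) (Y : Pointed.{u}) : Pointed.{u} where
  X := Quot (F.PreRel Y)
  point := Quot.mk _ ⟨⟨0⟩, fun _ => Y.point, rfl, (F.toFunctor.obj ⟨0⟩).point⟩

def extMap (F : SModule) {Y Z : Pointed.{u}} (g : Y ⟶ Z) : F.extObj Y ⟶ F.extObj Z where
  toFun := Quot.map
    (fun p => ⟨p.k, g.toFun ∘ p.pt, by simp [p.pt_zero, g.map_point], p.coeff⟩)
    (by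
      rintro _ _ ⟨f, y, hy, x⟩
      exact PreRel.mk f (g.toFun ∘ y) (by simp [hy, g.map_point]) x)
  map_point := by
    refine congrArg (Quot.mk _) ?_
    have : g.toFun ∘ (fun _ : Fin (0 + 1) => Y.point) = fun _ => Z.point := by
      funext; exact g.map_point
    simp [this]

/-- The extension of an s-module to an endofunctor of pointed sets. -/
def ext (F : SModule) : Pointed.{u} ⥤ Pointed.{u} where
  obj := F.extObj
  map := F.extMap
  map_id Y := by
    apply Pointed.Hom.ext
    funext x
    induction x using Quot.ind
    rfl
  map_comp f g := by
    apply Pointed.Hom.ext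
    funext x
    induction x using Quot.ind
    rfl

/-- A morphism of s-modules induces a natural map between the extensions. -/
def extNatTrans {F G : SModule} (φ : F.toFunctor ⟶ G.toFunctor) : F.ext ⟶ G.ext.{u} where
  app Y :=
    { toFun := Quot.map (fun p => ⟨p.k, p.pt, p.pt_zero, (φ.app p.k).toFun p.coeff⟩) (by
        rintro _ _ ⟨f, y, hy, x⟩
        have h := congrFun (congrArg Pointed.Hom.toFun (φ.naturality f)) x
        simp only [Pointed.Hom.comp_toFun', Function.comp_apply] at h
        rw [h]
        exact PreRel.mk f y hy _)
      map_point := by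
        refine congrArg (Quot.mk _) ?_
        simp [(φ.app _).map_point] }
  naturality Y Z g := by
    apply Pointed.Hom.ext
    funext x
    induction x using Quot.ind
    rfl

end SModule

namespace PointedSimplicial

/-- `x ∈ Wₙ` is spherical if all its faces are the base point. -/
def IsSpherical (W : SimplicialObject Pointed.{u}) : (n : ℕ) → (W.obj (op (.mk n))).X → Prop
  | 0, _ => True
  | n + 1, x => ∀ j : Fin (n + 2), (W.δ j).toFun x = (W.obj (op (.mk n))).point

/-- Spherical `n`-simplices `x`, `y` are related if there is `z ∈ Wₙ₊₁` with `∂ⱼ z = *` for `j < n`,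
`∂ₙ z = x` and `∂ₙ₊₁ z = y`. -/
def HomotopyRel (W : SimplicialObject Pointed.{u}) (n : ℕ)
    (x y : {x : (W.obj (op (.mk n))).X // IsSpherical W n x}) : Prop :=
  ∃ z : (W.obj (op (.mk (n + 1)))).X,
    (∀ j : Fin (n + 2), j.val < n → (W.δ j).toFun z = (W.obj (op (.mk n))).point) ∧
    (W.δ (Fin.last n).castSucc).toFun z = x.1 ∧
    (W.δ (Fin.last (n + 1))).toFun z = y.1

/-- The combinatorial homotopy `πₙ(W)`: spherical `n`-simplices modulo the equivalence relation
generated by `HomotopyRel`. -/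
def homotopy (W : SimplicialObject Pointed.{u}) (n : ℕ) : Type u :=
  Quot (HomotopyRel W n)

theorem naturality_δ {W W' : SimplicialObject Pointed.{u}} (φ : W ⟶ W') {n : ℕ} (j : Fin (n + 2))
    (x : (W.obj (op (.mk (n + 1)))).X) :
    (W'.δ j).toFun ((φ.app _).toFun x) = (φ.app _).toFun ((W.δ j).toFun x) :=
  (congrFun (congrArg Pointed.Hom.toFun (φ.naturality (SimplexCategory.δ j).op)) x).symm

theorem IsSpherical.map {W W' : SimplicialObject Pointed.{u}} (φ : W ⟶ W') :
    ∀ {n : ℕ} {x : (W.obj (op (.mk n))).X}, IsSpherical W n x → IsSpherical W' n ((φ.app _).toFun x)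
  | 0, _, _ => trivial
  | n + 1, x, h => fun j => by
      rw [naturality_δ, h j, Pointed.Hom.map_point]

def homotopyMap {W W' : SimplicialObject Pointed.{u}} (φ : W ⟶ W') (n : ℕ) :
    homotopy W n → homotopy W' n :=
  Quot.map (fun x => ⟨(φ.app _).toFun x.1, x.2.map φ⟩) (by
    rintro x y ⟨z, h0, h1, h2⟩
    refine ⟨(φ.app _).toFun z, fun j hj => ?_, ?_, ?_⟩
    · rw [naturality_δ, h0 j hj, Pointed.Hom.map_point]
    · rw [naturality_δ, h1]
    · rw [naturality_δ, h2])

end PointedSimplicial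

namespace SModule

open PointedSimplicial

/-- The pointed simplicial set `F ∘ K₊`, where `K₊` is `K` with a disjoint base point. -/
def onSSet (F : SModule) (K : SSet.{u}) : SimplicialObject Pointed.{u} :=
  ((SimplicialObject.whiskering _ _).obj (typeToPointed ⋙ F.ext)).obj K

/-- The homology `Hₙ(K; F) = πₙ(F ∘ K₊)` of a simplicial set with coefficients in an s-module. -/
def homology (F : SModule) (K : SSet.{u}) (n : ℕ) : Type u :=
  homotopy (F.onSSet K) n

/-- Functoriality of homology in the s-module. -/
def homologyMap {F G : SModule} (φ : F.toFunctor ⟶ G.toFunctor) (K : SSet.{u}) (n : ℕ) :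
    F.homology K n → G.homology K n :=
  homotopyMap (Functor.whiskerLeft K (Functor.whiskerLeft typeToPointed (extNatTrans φ))) n

/-- Push-forward of a tuple `φ : k₊ ∖ {0} → A` along `f : k₊ → l₊`: sum over the fibres, where the
fibre over the base point is dropped. -/
def push {A : Type} [AddCommMonoid A] {k l : GammaOp} (f : k ⟶ l) (φ : Fin k.card → A) :
    Fin l.card → A :=
  fun j => ∑ i with f.1 i.succ = j.succ, φ i

theorem push_id {A : Type} [AddCommMonoid A] {k : GammaOp} (φ : Fin k.card → A) :
    push (𝟙 k) φ = φ := by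
  funext j
  have h : ∀ i : Fin k.card, (𝟙 k : k ⟶ k).1 i.succ = i.succ := fun _ => rfl
  simp only [push, h, Fin.succ_inj]
  simp [Finset.sum_filter]

theorem push_comp {A : Type} [AddCommMonoid A] {k l m : GammaOp} (f : k ⟶ l) (g : l ⟶ m)
    (φ : Fin k.card → A) : push (f ≫ g) φ = push g (push f φ) := by
  funext j
  have h : ∀ i, (f ≫ g).1 i = g.1 (f.1 i) := fun _ => rfl
  simp only [push, h, Finset.sum_filter]
  simp only [← Finset.sum_filter (fun i : Fin l.card => g.1 i.succ = j.succ)]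
  rw [Finset.sum_comm]
  refine Finset.sum_congr rfl fun i _ => ?_
  rcases Fin.eq_zero_or_eq_succ (f.1 i.succ) with h0 | ⟨a, ha⟩
  · rw [h0, g.2, if_neg (Fin.succ_ne_zero j).symm]
    refine (Finset.sum_eq_zero fun b _ => ?_).symm
    rw [if_neg (Fin.succ_ne_zero b).symm]
  · simp only [ha, Fin.succ_inj]
    rw [Finset.sum_ite_eq]
    simp

/-- The Eilenberg–MacLane s-module `HA`: `HA(k₊) = Aᵏ`, with summation over the fibres. -/
def eilenbergMacLane (A : Type) [AddCommMonoid A] : SModule where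
  toFunctor :=
    { obj := fun k => ⟨Fin k.card → A, 0⟩
      map := fun f => ⟨push f, by funext; simp [push]⟩
      map_id := fun _ => Pointed.Hom.ext (funext fun φ => push_id φ)
      map_comp := fun f g => Pointed.Hom.ext (funext fun φ => push_comp f g φ) }
  subsingleton_zero := (inferInstance : Subsingleton (Fin 0 → A))

theorem sum_abs_push_le {k l : GammaOp} (f : k ⟶ l) (φ : Fin k.card → ℝ) :
    ∑ j, |push f φ j| ≤ ∑ i, |φ i| := by
  calc ∑ j, |push f φ j| ≤ ∑ j, ∑ i with f.1 i.succ = j.succ, |φ i| :=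
        Finset.sum_le_sum fun j _ => Finset.abs_sum_le_sum_abs _ _
    _ = ∑ i, ∑ j : Fin l.card, if f.1 i.succ = j.succ then |φ i| else 0 := by
        simp only [Finset.sum_filter]
        rw [Finset.sum_comm]
    _ ≤ ∑ i, |φ i| := by
        refine Finset.sum_le_sum fun i _ => ?_
        rcases Fin.eq_zero_or_eq_succ (f.1 i.succ) with h0 | ⟨a, ha⟩
        · rw [Finset.sum_eq_zero fun b _ => ?_]
          · exact abs_nonneg _
          · rw [h0, if_neg (Fin.succ_ne_zero b).symm]
        · simp only [ha, Fin.succ_inj]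
          rw [Finset.sum_ite_eq]
          simp

/-- The sub-s-module `‖Hℝ‖_r` of `Hℝ`, for `r > 0`: the tuples `φ ∈ ℝᵏ` with `∑ |φ i| < r`. -/
def normHR (r : ℝ) (hr : 0 < r) : SModule where
  toFunctor :=
    { obj := fun k => ⟨{φ : Fin k.card → ℝ // ∑ i, |φ i| < r}, ⟨0, by simpa using hr⟩⟩
      map := fun f => ⟨fun φ => ⟨push f φ.1, (sum_abs_push_le f φ.1).trans_lt φ.2⟩,
        Subtype.ext (by funext; simp [push])⟩
      map_id := fun _ => Pointed.Hom.ext (funext fun φ => Subtype.ext (push_id φ.1))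
      map_comp := fun f g => Pointed.Hom.ext (funext fun φ => Subtype.ext (push_comp f g φ.1)) }
  subsingleton_zero :=
    (inferInstance : Subsingleton {φ : Fin 0 → ℝ // ∑ i, |φ i| < r})

/-- The inclusion `‖Hℝ‖_r → Hℝ`. -/
def normHRIncl (r : ℝ) (hr : 0 < r) :
    (normHR r hr).toFunctor ⟶ (eilenbergMacLane ℝ).toFunctor where
  app _ := ⟨Subtype.val, rfl⟩
  naturality _ _ _ := rfl

end SModule

namespace SingularHomology

/-- The free real vector space functor. -/
noncomputable def realFree : Type u ⥤ ModuleCat.{u} ℝ where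
  obj S := ModuleCat.of ℝ (S →₀ ℝ)
  map f := ModuleCat.ofHom (Finsupp.lmapDomain ℝ ℝ f)
  map_id S := by
    ext : 1
    exact Finsupp.lmapDomain_id ℝ ℝ
  map_comp f g := by
    ext : 1
    exact Finsupp.lmapDomain_comp ℝ ℝ f g

/-- The free real chain complex of a simplicial set `K`: `Cₙ` has basis `Kₙ`, with differential the
alternating sum of the faces. -/
noncomputable def chains (K : SSet.{u}) : ChainComplex (ModuleCat.{u} ℝ) ℕ :=
  (AlgebraicTopology.alternatingFaceMapComplex (ModuleCat.{u} ℝ)).obj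
    (((SimplicialObject.whiskering _ _).obj realFree).obj K)

/-- Regard a finitely supported function on the `n`-simplices as an `n`-chain; `Cₙ` is by definition
the space of these functions. -/
noncomputable def toChain (K : SSet.{u}) (n : ℕ) (c : K.obj (op (.mk n)) →₀ ℝ) :
    (chains K).X n := c

/-- The chain `c` is a cycle. -/
def IsCycle (K : SSet.{u}) (n : ℕ) (c : K.obj (op (.mk n)) →₀ ℝ) : Prop :=
  ∀ m : ℕ, (chains K).d n m (toChain K n c) = 0

/-- The homology class of a cycle. -/
noncomputable def homologyClass (K : SSet.{u}) (n : ℕ) (c : K.obj (op (.mk n)) →₀ ℝ)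
    (hc : IsCycle K n c) : (chains K).homology n :=
  (chains K).homologyπ n ((chains K).cyclesMk (toChain K n c) _ rfl (hc _))

/-- The `ℓ¹`-norm of a chain with respect to the basis of simplices. -/
noncomputable def chainNorm {K : SSet.{u}} {n : ℕ} (c : K.obj (op (.mk n)) →₀ ℝ) : ℝ :=
  c.sum fun _ a => |a|

theorem sum_zsmul_apply {M N : ModuleCat.{u} ℝ} {m : ℕ} (f : Fin m → (M ⟶ N)) (x : M) :
    (∑ j : Fin m, (-1 : ℤ) ^ (j : ℕ) • f j) x = ∑ j : Fin m, (-1 : ℝ) ^ (j : ℕ) • (f j) x := by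
  refine (LinearMap.congr_fun (ModuleCat.hom_sum
    (fun j : Fin m => (-1 : ℤ) ^ (j : ℕ) • f j) Finset.univ) x).trans ?_
  rw [LinearMap.sum_apply]
  refine Finset.sum_congr rfl fun j _ => ?_
  rw [ModuleCat.hom_zsmul, LinearMap.smul_apply, ← Int.cast_smul_eq_zsmul ℝ]
  push_cast
  rfl

/-- The boundary as alternating sum of the faces. -/
theorem d_toChain (K : SSet.{u}) (n : ℕ) (c : K.obj (op (.mk (n + 1))) →₀ ℝ) :
    (chains K).d (n + 1) n (toChain K (n + 1) c) =
      toChain K n (∑ j : Fin (n + 2), (-1 : ℝ) ^ (j : ℕ) • c.mapDomain (SimplicialObject.δ K j)) := by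
  have h : (chains K).d (n + 1) n = ∑ j : Fin (n + 2), (-1 : ℤ) ^ (j : ℕ) •
      (((SimplicialObject.whiskering _ _).obj realFree).obj K).δ j :=
    AlgebraicTopology.AlternatingFaceMapComplex.obj_d_eq _ n
  refine (congrArg (fun φ : (chains K).X (n + 1) ⟶ (chains K).X n =>
    φ (toChain K (n + 1) c)) h).trans ?_
  exact sum_zsmul_apply
    (fun j => (((SimplicialObject.whiskering _ _).obj realFree).obj K).δ j) _

theorem homologyClass_eq (K : SSet.{u}) (n : ℕ) (c c' : K.obj (op (.mk n)) →₀ ℝ)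
    (hc : IsCycle K n c) (hc' : IsCycle K n c') (b : (chains K).X (n + 1))
    (h : (chains K).d (n + 1) n b = toChain K n c - toChain K n c') :
    homologyClass K n c hc = homologyClass K n c' hc' := by
  rw [← sub_eq_zero]
  unfold homologyClass
  rw [← map_sub]
  have hz : (chains K).cyclesMk (toChain K n c) _ rfl (hc _) -
      (chains K).cyclesMk (toChain K n c') _ rfl (hc' _) = (chains K).toCycles (n + 1) n b := by
    apply (ModuleCat.mono_iff_injective ((chains K).iCycles n)).1 inferInstance
    rw [map_sub, ← ModuleCat.comp_apply, HomologicalComplex.toCycles_i, h]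
    exact congrArg₂ (· - ·) ((chains K).i_cyclesMk _ _ _ _) ((chains K).i_cyclesMk _ _ _ _)
  erw [hz]
  rw [← ModuleCat.comp_apply, HomologicalComplex.toCycles_comp_homologyπ]
  rfl

/-- The real singular homology `Hₙ(X; ℝ)`. -/
noncomputable abbrev H (X : TopCat.{u}) (n : ℕ) : ModuleCat.{u} ℝ :=
  (chains (TopCat.toSSet.obj X)).homology n

/-- Gromov's `ℓ¹`-semi-norm on `Hₙ(X; ℝ)`. -/
noncomputable def l1Seminorm (X : TopCat.{u}) (n : ℕ) (α : H X n) : ℝ :=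
  sInf {r : ℝ | ∃ (c : (TopCat.toSSet.obj X).obj (op (.mk n)) →₀ ℝ)
    (hc : IsCycle (TopCat.toSSet.obj X) n c),
    homologyClass (TopCat.toSSet.obj X) n c hc = α ∧ chainNorm c = r}

end SingularHomology

namespace SModule

open SingularHomology PointedSimplicial

/-- The chain `∑ φ i • y i` (terms with `y i` the base point being dropped) given by a pointed map
`y : k₊ → S₊` and `φ ∈ ℝᵏ`. -/
noncomputable def preToFree (S : Type u) (p : (eilenbergMacLane ℝ).Pre (typeToPointed.obj S)) :
    S →₀ ℝ :=
  ∑ i : Fin p.k.card,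
    Option.elim (α := S) (p.pt i.succ) 0 (fun s => Finsupp.single s ((p.coeff : Fin p.k.card → ℝ) i))

/-- The canonical identification of `Hℝ(S₊)` with the real vector space with basis `S`. -/
noncomputable def extToFree (S : Type u) :
    ((eilenbergMacLane ℝ).ext.obj (typeToPointed.obj S)).X → (S →₀ ℝ) :=
  Quot.lift (preToFree S) (by
    rintro _ _ ⟨f, y, hy, x⟩
    show ∑ i, _ = ∑ j, _
    have hs : ∀ j, Option.elim (α := S) (y j.succ) 0
        (fun s => Finsupp.single s (push f (x : Fin _ → ℝ) j)) =
        ∑ i, if f.1 i.succ = j.succ then Option.elim (α := S) (y j.succ) 0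
          (fun s => Finsupp.single s ((x : Fin _ → ℝ) i)) else 0 := by
      intro j
      rw [← Finset.sum_filter]
      cases h : (y j.succ : Option S) with
      | none => simp
      | some s =>
        simp only [Option.elim_some, push]
        exact map_sum (Finsupp.singleAddHom s) _ _
    refine Eq.trans ?_ (Finset.sum_congr rfl fun j _ => (hs j).symm)
    rw [Finset.sum_comm]
    refine Finset.sum_congr rfl fun i _ => ?_
    rcases Fin.eq_zero_or_eq_succ (f.1 i.succ) with h0 | ⟨a, ha⟩
    · rw [Finset.sum_eq_zero fun b _ => ?_]
      · have : (y (f.1 i.succ) : Option S) = none := by rw [h0]; exact hy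
        simp [this]
      · rw [h0, if_neg (Fin.succ_ne_zero b).symm]
    · simp only [ha, Fin.succ_inj, Function.comp_apply]
      rw [Finset.sum_ite_eq]
      simp)

theorem extToFree_point (S : Type u) :
    extToFree S ((eilenbergMacLane ℝ).ext.obj (typeToPointed.obj S)).point = 0 := by
  show preToFree S _ = 0
  exact Finset.sum_eq_zero fun (i : Fin 0) _ => i.elim0

theorem extToFree_map {S T : Type u} (g : S ⟶ T)
    (x : ((eilenbergMacLane ℝ).ext.obj (typeToPointed.obj S)).X) :
    extToFree T (((eilenbergMacLane ℝ).ext.map (typeToPointed.map g)).toFun x) =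
      (extToFree S x).mapDomain g := by
  induction x using Quot.ind with
  | mk p =>
    show preToFree T _ = Finsupp.mapDomain g (preToFree S p)
    unfold preToFree
    rw [Finsupp.mapDomain_finsetSum]
    refine Finset.sum_congr rfl fun i _ => ?_
    show Option.elim (Option.map g (p.pt i.succ)) _ _ = _
    cases h : (p.pt i.succ : Option S) with
    | none => simp
    | some s => simp

theorem extToFree_δ (K : SSet.{u}) (n : ℕ) (j : Fin (n + 2))
    (x : (((eilenbergMacLane ℝ).onSSet K).obj (op (.mk (n + 1)))).X) :
    (extToFree (K.obj (op (.mk (n + 1)))) x).mapDomain (SimplicialObject.δ K j) =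
      extToFree (K.obj (op (.mk n))) ((((eilenbergMacLane ℝ).onSSet K).δ j).toFun x) :=
  (extToFree_map (SimplicialObject.δ K j) x).symm

theorem isCycle_of_isSpherical (K : SSet.{u}) : ∀ (n : ℕ)
    (x : (((eilenbergMacLane ℝ).onSSet K).obj (op (.mk n))).X),
    IsSpherical ((eilenbergMacLane ℝ).onSSet K) n x →
      IsCycle K n (extToFree (K.obj (op (.mk n))) x) := by
  intro n x hx m
  by_cases h : m + 1 = n
  · subst h
    rw [d_toChain, Finset.sum_eq_zero]
    · rfl
    · intro j _
      rw [extToFree_δ, hx j]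
      erw [extToFree_point]
      simp
  · rw [(chains K).shape n m h]
    rfl

/-- The canonical map `Hₙ(K; Hℝ) → Hₙ(K; ℝ)`, sending a spherical simplex of `Hℝ ∘ K₊` to the class
of the corresponding cycle. -/
noncomputable def homologyHRTo (K : SSet.{u}) (n : ℕ) :
    (eilenbergMacLane ℝ).homology K n → (chains K).homology n :=
  Quot.lift (fun x => homologyClass K n (extToFree _ x.1) (isCycle_of_isSpherical K n x.1 x.2)) (by
    rintro x y ⟨z, h0, h1, h2⟩
    have hsq : ((-1 : ℝ) ^ n) * (-1) ^ n = 1 := by rw [← mul_pow]; simp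
    refine homologyClass_eq K n _ _ _ _ (toChain K (n + 1) ((-1 : ℝ) ^ n • extToFree _ z)) ?_
    rw [d_toChain, Fin.sum_univ_castSucc, Fin.sum_univ_castSucc, Finset.sum_eq_zero]
    · simp only [Finsupp.mapDomain_smul]
      rw [extToFree_δ, extToFree_δ, h1, h2, smul_smul, smul_smul]
      simp only [Fin.val_castSucc, Fin.val_last, pow_succ, zero_add]
      rw [mul_right_comm, hsq, one_smul, one_mul, neg_one_smul, ← sub_eq_add_neg]
      rfl
    · intro j _
      rw [Finsupp.mapDomain_smul, extToFree_δ, h0 _ j.2]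
      erw [extToFree_point]
      simp)

/-- The canonical map `Hₙ(X; ‖Hℝ‖_r) → Hₙ(X; ℝ)` for a topological space `X`. -/
noncomputable def rho (X : TopCat.{u}) (n : ℕ) (r : ℝ) (hr : 0 < r) :
    (normHR r hr).homology (TopCat.toSSet.obj X) n → H X n :=
  fun x => homologyHRTo (TopCat.toSSet.obj X) n
    (homologyMap (normHRIncl r hr) (TopCat.toSSet.obj X) n x)

/-- The Connes–Consani semi-norm on `Hₙ(X; ℝ)`, defined by the filtration by the images of the
`Hₙ(X; ‖Hℝ‖_r)`. -/
noncomputable def ccSeminorm (X : TopCat.{u}) (n : ℕ) (α : H X n) : ℝ :=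
  sInf {r : ℝ | ∃ hr : 0 < r, α ∈ Set.range (rho X n r hr)}

end SModule

/-! A spherical simplex of `‖Hℝ‖_r ∘ S(X)₊` gives a cycle of norm less than `r`, so classes in the
image have small semi-norm. Conversely, a cycle only has vanishing alternating sum of faces, while
sphericity asks every face to vanish separately. Antisymmetrizing over the vertex permutations
closes this gap. The faces of an antisymmetrized chain agree up to the sign `(-1)^j`, so its
boundary is a nonzero multiple of its zeroth face; if the boundary vanishes, so does every face
(`mapDomain_face_act_alt`). Antisymmetrization is an average of signed relabelings, hence does not
increase the norm (`sum_abs_act_alt_le`), and it is chain homotopic to the identity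
(`boundary_altHomotopy_succ`), hence preserves the class.

Chains of norm less than `r` lift to `‖Hℝ‖_r(S₊)` (`exists_normToFree_eq`), and only the base point
lies over the zero chain (`eq_point_of_normToFree_eq_zero`), so zero faces of the chain become
base-point faces of the lift. The open balls in `‖Hℝ‖_r` match the strict inequality against an
infimum that need not be attained. -/

/-! ### Symmetric sets and linear combinations of vertex maps -/

/-- A symmetric set: a contravariant functor on the nonempty finite sets `{0, …, n}` and all maps
between them. -/
structure SymmetricSet where
  obj : ℕ → Type u
  map {m n : ℕ} (f : Fin (m + 1) → Fin (n + 1)) : obj n → obj m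
  map_id {n : ℕ} (x : obj n) : map id x = x
  map_comp {l m n : ℕ} (f : Fin (l + 1) → Fin (m + 1)) (g : Fin (m + 1) → Fin (n + 1))
    (x : obj n) : map (g ∘ f) x = map f (map g x)

namespace SymmetricSet

/-- The symmetric set of tuples in `V`. -/
abbrev tuples (V : Type u) : SymmetricSet.{u} where
  obj n := Fin (n + 1) → V
  map f v := v ∘ f
  map_id _ := rfl
  map_comp _ _ _ := rfl

/-- The `n`-chains of a symmetric set. -/
abbrev Chain (K : SymmetricSet.{u}) (n : ℕ) : Type u := K.obj n →₀ ℝ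

/-- Formal linear combinations of maps `{0, …, m} → {0, …, n}`. -/
abbrev Op (m n : ℕ) : Type := (tuples (Fin (n + 1))).Chain m

/-- The operation of a formal linear combination of maps on the chains of a symmetric set. -/
noncomputable def act (K : SymmetricSet.{u}) {m n : ℕ} :
    Op m n →ₗ[ℝ] K.Chain n →ₗ[ℝ] K.Chain m :=
  Finsupp.linearCombination ℝ fun f : Fin (m + 1) → Fin (n + 1) =>
    Finsupp.lmapDomain ℝ ℝ (K.map f)

/-- A map, as an operation. -/
noncomputable def Op.of {m n : ℕ} (f : Fin (m + 1) → Fin (n + 1)) : Op m n :=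
  Finsupp.single f 1

theorem act_of (K : SymmetricSet.{u}) {m n : ℕ} (f : Fin (m + 1) → Fin (n + 1)) (c : K.Chain n) :
    K.act (Op.of f) c = c.mapDomain (K.map f) := by
  simp only [act, Op.of]
  erw [Finsupp.linearCombination_single]
  simp

theorem act_of_single (K : SymmetricSet.{u}) {m n : ℕ} (f : Fin (m + 1) → Fin (n + 1))
    (x : K.obj n) (r : ℝ) :
    K.act (Op.of f) (Finsupp.single x r) = Finsupp.single (K.map f x) r := by
  rw [act_of, Finsupp.mapDomain_single]

theorem Op.linearMap_ext {m n : ℕ} {M : Type*} [AddCommGroup M] [Module ℝ M]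
    {φ ψ : Op m n →ₗ[ℝ] M} (h : ∀ f, φ (Op.of f) = ψ (Op.of f)) : φ = ψ :=
  Finsupp.lhom_ext' fun f => LinearMap.ext_ring (h f)

theorem Chain.linearMap_ext {K : SymmetricSet.{u}} {n : ℕ} {M : Type*} [AddCommGroup M]
    [Module ℝ M] {φ ψ : K.Chain n →ₗ[ℝ] M}
    (h : ∀ x, φ (Finsupp.single x 1) = ψ (Finsupp.single x 1)) : φ = ψ :=
  Finsupp.lhom_ext' fun x => LinearMap.ext_ring (h x)

theorem act_id (K : SymmetricSet.{u}) {n : ℕ} (c : K.Chain n) : K.act (Op.of id) c = c := by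
  rw [act_of, show K.map (id : Fin (n + 1) → Fin (n + 1)) = id from funext K.map_id,
    Finsupp.mapDomain_id]

theorem of_act_of {l m n : ℕ} (f : Fin (l + 1) → Fin (m + 1)) (g : Fin (m + 1) → Fin (n + 1)) :
    (tuples _).act (Op.of f) (Op.of g) = Op.of (g ∘ f) :=
  act_of_single _ _ _ _

/-- The identity tuple is the universal simplex: an operation is determined by its value there, so
identities between operations can be checked on chains of tuples. -/
theorem act_of_id {m n : ℕ} (a : Op m n) : (tuples _).act a (Op.of id) = a := by
  revert a
  refine LinearMap.congr_fun (f := (tuples _).act.flip (Op.of id)) (g := LinearMap.id)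
    (Op.linearMap_ext fun f => ?_)
  exact of_act_of f id

/-- By linearity this is functoriality of `K.map`. It transfers every identity proved in `Op` to the
chains of an arbitrary symmetric set, in particular to singular chains. -/
theorem act_act (K : SymmetricSet.{u}) {l m n : ℕ} (a : Op l m) (b : Op m n) (c : K.Chain n) :
    K.act ((tuples _).act a b) c = K.act a (K.act b c) := by
  have h : (((tuples (Fin (n + 1))).act (m := l) (n := m)).compr₂ K.act) =
      (LinearMap.llcomp ℝ (K.Chain n) (K.Chain m) (K.Chain l)).compl₁₂ K.act K.act := by
    refine Op.linearMap_ext fun f => Op.linearMap_ext fun g => Chain.linearMap_ext fun x => ?_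
    simp only [LinearMap.compr₂_apply, LinearMap.compl₁₂_apply, LinearMap.llcomp_apply, of_act_of,
      act_of_single, K.map_comp]
  exact LinearMap.congr_fun (LinearMap.congr_fun (LinearMap.congr_fun h a) b) c

/-! ### Boundaries and cones of tuples -/

/-- The alternating sum of the face maps. -/
noncomputable def boundary (n : ℕ) : Op n (n + 1) :=
  ∑ j : Fin (n + 2), (-1 : ℝ) ^ (j : ℕ) • Op.of j.succAbove

theorem act_boundary (K : SymmetricSet.{u}) {n : ℕ} (c : K.Chain (n + 1)) :
    K.act (boundary n) c =
      ∑ j : Fin (n + 2), (-1 : ℝ) ^ (j : ℕ) • c.mapDomain (K.map j.succAbove) := by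
  simp only [boundary, map_sum, map_smul, LinearMap.sum_apply, LinearMap.smul_apply, act_of]

/-- The cone with apex `b`. -/
noncomputable def cone {V : Type u} (b : V) (m : ℕ) :
    (tuples V).Chain m →ₗ[ℝ] (tuples V).Chain (m + 1) :=
  Finsupp.lmapDomain ℝ ℝ fun v : Fin (m + 1) → V => (Fin.cons b v : Fin (m + 2) → V)

theorem cone_single {V : Type u} (b : V) {m : ℕ} (v : Fin (m + 1) → V) (r : ℝ) :
    cone b m (Finsupp.single v r) =
      Finsupp.single (Fin.cons b v : Fin (m + 2) → V) r :=
  Finsupp.mapDomain_single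

theorem act_boundary_single {V : Type u} {n : ℕ} (v : Fin (n + 2) → V) :
    (tuples V).act (boundary n) (Finsupp.single v 1) =
      ∑ j : Fin (n + 2), (-1 : ℝ) ^ (j : ℕ) •
        (Finsupp.single (v ∘ j.succAbove) 1 : (tuples V).Chain n) := by
  rw [act_boundary]
  exact Finset.sum_congr rfl fun j _ => by rw [Finsupp.mapDomain_single]

theorem boundary_cone {V : Type u} (b : V) {m : ℕ} (c : (tuples V).Chain (m + 1)) :
    (tuples V).act (boundary (m + 1)) (cone b (m + 1) c) =
      c - cone b m ((tuples V).act (boundary m) c) := by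
  revert c
  refine LinearMap.congr_fun (f := (tuples V).act (boundary (m + 1)) ∘ₗ cone b (m + 1))
    (g := LinearMap.id - cone b m ∘ₗ (tuples V).act (boundary m)) (Chain.linearMap_ext fun v => ?_)
  simp only [LinearMap.comp_apply, LinearMap.sub_apply, LinearMap.id_apply]
  erw [cone_single, act_boundary_single, act_boundary_single]
  rw [Fin.sum_univ_succ, map_sum, sub_eq_add_neg, ← Finset.sum_neg_distrib]
  congr 1
  -- The zeroth face deletes the apex; face `j + 1` of the cone is the cone over face `j`, with the
  -- opposite sign.
  · simp only [Fin.val_zero, pow_zero, one_smul]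
    rfl
  · refine Finset.sum_congr rfl fun j _ => ?_
    rw [map_smul]
    erw [cone_single]
    rw [Fin.val_succ, pow_succ, mul_neg_one, neg_smul]
    congr 3
    funext i
    refine Fin.cases rfl (fun i => ?_) i
    exact (congrArg (Fin.cons b v : Fin (m + 3) → V) (Fin.succ_succAbove_succ j i)).trans rfl

/-- In degree zero the remaining face of each cone is its apex, which contributes the augmentation
times that vertex. -/
theorem boundary_cone_zero {V : Type u} (b : V) (c : (tuples V).Chain 0) :
    (tuples V).act (boundary 0) (cone b 0 c) =
      c - Finsupp.linearCombination ℝ (fun _ => (1 : ℝ)) c •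
        (Finsupp.single (fun _ : Fin 1 => b) 1 : (tuples V).Chain 0) := by
  revert c
  refine LinearMap.congr_fun (f := (tuples V).act (boundary 0) ∘ₗ cone b 0)
    (g := LinearMap.id - (LinearMap.toSpanSingleton ℝ _
      (Finsupp.single (fun _ : Fin 1 => b) 1 : (tuples V).Chain 0)) ∘ₗ
        Finsupp.linearCombination ℝ (fun _ => (1 : ℝ))) (Chain.linearMap_ext fun v => ?_)
  simp only [LinearMap.comp_apply, LinearMap.sub_apply, LinearMap.id_apply]
  erw [cone_single, act_boundary_single]
  rw [Fin.sum_univ_two, sub_eq_add_neg]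
  simp only [Fin.val_zero, pow_zero, one_smul, Fin.val_one, pow_one, neg_smul,
    Finsupp.linearCombination_single, LinearMap.toSpanSingleton_apply, smul_eq_mul, mul_one]
  congr 2
  congr 1
  funext i
  obtain rfl : i = 0 := Subsingleton.elim (α := Fin 1) i 0
  rfl

theorem linearCombination_one_boundary {V : Type u} (c : (tuples V).Chain 1) :
    Finsupp.linearCombination ℝ (fun _ => (1 : ℝ)) ((tuples V).act (boundary 0) c) = 0 := by
  revert c
  refine LinearMap.congr_fun (f := Finsupp.linearCombination ℝ (fun _ => (1 : ℝ)) ∘ₗ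
    (tuples V).act (boundary 0)) (g := 0) (Chain.linearMap_ext fun v => ?_)
  rw [LinearMap.comp_apply]
  erw [act_boundary_single]
  simp [Fin.sum_univ_two]

/-- Every tuple is the cone over its tail, so the cone formula yields the vanishing by induction,
without the simplicial identities. -/
theorem boundary_boundary_apply {V : Type u} : ∀ {n : ℕ} (c : (tuples V).Chain (n + 2)),
    (tuples V).act (boundary n) ((tuples V).act (boundary (n + 1)) c) = 0 := by
  intro n
  induction n with
  | zero =>
    refine LinearMap.congr_fun (f := (tuples V).act (boundary 0) ∘ₗ (tuples V).act (boundary 1))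
      (g := 0) (Chain.linearMap_ext fun v => ?_)
    obtain ⟨b, w, rfl⟩ : ∃ (b : V) (w : Fin 2 → V), v = (Fin.cons b w : Fin 3 → V) :=
      ⟨_, _, (Fin.cons_self_tail v).symm⟩
    rw [LinearMap.comp_apply, ← cone_single, boundary_cone, map_sub, boundary_cone_zero,
      linearCombination_one_boundary]
    simp
  | succ n ih =>
    refine LinearMap.congr_fun (f := (tuples V).act (boundary (n + 1)) ∘ₗ
      (tuples V).act (boundary (n + 2))) (g := 0) (Chain.linearMap_ext fun v => ?_)
    obtain ⟨b, w, rfl⟩ : ∃ (b : V) (w : Fin (n + 3) → V), v = (Fin.cons b w : Fin (n + 4) → V) :=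
      ⟨_, _, (Fin.cons_self_tail v).symm⟩
    rw [LinearMap.comp_apply, ← cone_single, boundary_cone, map_sub, boundary_cone, ih]
    simp

theorem boundary_act_boundary (n : ℕ) :
    (tuples _).act (boundary n) (boundary (n + 1)) = 0 := by
  rw [← act_of_id ((tuples _).act (boundary n) (boundary (n + 1))), act_act,
    boundary_boundary_apply]

/-! ### Antisymmetrization and its chain homotopy to the identity -/

/-- The sum of the permutations of `{0, …, n}`, weighted by their signs. -/
noncomputable def signedSum (n : ℕ) : Op n n :=
  ∑ τ : Equiv.Perm (Fin (n + 1)), ((Equiv.Perm.sign τ : ℤ) : ℝ) • Op.of τ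

/-- The map `j.succAbove` is `Fin.succ` followed by a cycle of sign `(-1)^j`; that cycle is absorbed
by reindexing the permutations. -/
theorem face_act_signedSum (n : ℕ) (j : Fin (n + 2)) :
    (tuples _).act (Op.of j.succAbove) (signedSum (n + 1)) =
      (-1 : ℝ) ^ (j : ℕ) • (tuples _).act (Op.of Fin.succ) (signedSum (n + 1)) := by
  simp only [signedSum, map_sum, map_smul, of_act_of, Finset.smul_sum]
  refine Fintype.sum_equiv (Equiv.mulRight j.cycleRange.symm) _ _ fun τ => ?_
  have h : τ ∘ j.succAbove = (τ * j.cycleRange.symm : Equiv.Perm _) ∘ Fin.succ := by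
    funext i
    simp
  rw [Equiv.coe_mulRight, ← h, smul_smul, Equiv.Perm.sign_mul, Equiv.Perm.sign_symm,
    Fin.sign_cycleRange]
  congr 1
  have : ((-1 : ℝ) ^ (j : ℕ)) * (-1) ^ (j : ℕ) = 1 := by rw [← mul_pow]; simp
  push_cast
  rw [mul_left_comm, this, mul_one]

theorem boundary_act_signedSum (n : ℕ) :
    (tuples _).act (boundary n) (signedSum (n + 1)) =
      ((n : ℝ) + 2) • (tuples _).act (Op.of Fin.succ) (signedSum (n + 1)) := by
  have hsq (j : ℕ) : ((-1 : ℝ) ^ j) * (-1) ^ j = 1 := by rw [← mul_pow]; simp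
  simp only [boundary, map_sum, map_smul, LinearMap.sum_apply, LinearMap.smul_apply,
    face_act_signedSum, smul_smul, hsq, one_smul]
  rw [Finset.sum_const, Finset.card_univ, Fintype.card_fin, ← Nat.cast_smul_eq_nsmul ℝ]
  push_cast
  rfl

theorem signedSum_act_boundary (n : ℕ) :
    (tuples _).act (signedSum n) (boundary n) =
      (tuples _).act (Op.of Fin.succ) (signedSum (n + 1)) := by
  simp only [boundary, signedSum, map_sum, map_smul, LinearMap.sum_apply, LinearMap.smul_apply,
    of_act_of, Finset.smul_sum]
  rw [← Finset.univ.sum_product']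
  -- The permutation `e (j, σ)` sends `0` to `j` and `i + 1` to `j.succAbove (σ i)`, and has sign
  -- `(-1)^j` times that of `σ`. Each permutation arises exactly once, `j` being its value at `0`.
  let e : Fin (n + 2) × Equiv.Perm (Fin (n + 1)) → Equiv.Perm (Fin (n + 2)) := fun p =>
    p.1.cycleRange.symm * Equiv.Perm.decomposeFin.symm (0, p.2)
  have he0 (p) : e p 0 = p.1 := by simp [e]
  have hinj : Function.Injective e := by
    rintro ⟨i, σ⟩ ⟨j, τ⟩ h
    obtain rfl : i = j := by simpa only [he0] using Equiv.congr_fun h 0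
    simpa [e] using h
  have hbij : Function.Bijective e := by
    rw [Fintype.bijective_iff_injective_and_card]
    refine ⟨hinj, ?_⟩
    simp [Fintype.card_perm, Nat.factorial_succ]
  refine Fintype.sum_equiv (Equiv.ofBijective e hbij) _ _ fun p => ?_
  have h : p.1.succAbove ∘ p.2 = e p ∘ Fin.succ := by
    funext i
    simp [e]
  rw [Equiv.ofBijective_apply, ← h, smul_smul]
  simp [e]

/-- Antisymmetrization. -/
noncomputable def alt (n : ℕ) : Op n n := ((n + 1).factorial : ℝ)⁻¹ • signedSum n

theorem alt_zero : alt 0 = Op.of id := by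
  have : Subsingleton (Fin (0 + 1)) := inferInstanceAs (Subsingleton (Fin 1))
  simp only [alt, signedSum, Fintype.sum_unique]
  simp

/-- The `n + 2` equal faces of the signed sum account for the quotient of the two normalizing
factorials. -/
theorem boundary_act_alt (n : ℕ) :
    (tuples _).act (boundary n) (alt (n + 1)) = (tuples _).act (alt n) (boundary n) := by
  have h2 : ((n : ℝ) + 2) ≠ 0 := by positivity
  have hf : ((n + 1).factorial : ℝ) ≠ 0 := by positivity
  simp only [alt, map_smul, LinearMap.smul_apply, boundary_act_signedSum, signedSum_act_boundary,
    smul_smul]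
  congr 1
  rw [Nat.factorial_succ (n + 1)]
  push_cast
  field_simp
  ring

/-- The chain homotopy between antisymmetrization and the identity. -/
noncomputable def altHomotopy : (n : ℕ) → Op (n + 1) n
  | 0 => 0
  | n + 1 => cone 0 _ (alt (n + 1) - Op.of id - (tuples _).act (altHomotopy n) (boundary n))

theorem boundary_altHomotopy_zero :
    (tuples _).act (boundary 0) (altHomotopy 0) = alt 0 - Op.of id := by
  rw [alt_zero, altHomotopy, map_zero, sub_self]

/-- This is the method of acyclic models: the chain being coned off is a cycle, by the previous
degree and the fact that `alt` commutes with the boundary, so the correction term of `boundary_cone`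
vanishes. -/
theorem boundary_altHomotopy_succ (n : ℕ) :
    (tuples _).act (boundary (n + 1)) (altHomotopy (n + 1)) =
      alt (n + 1) - Op.of id - (tuples _).act (altHomotopy n) (boundary n) := by
  induction n with
  | zero =>
    rw [altHomotopy.eq_2, boundary_cone]
    simp only [map_sub, boundary_act_alt, act_of_id, ← act_act, boundary_altHomotopy_zero,
      LinearMap.sub_apply, act_id, sub_self, map_zero, sub_zero]
  | succ n ih =>
    rw [altHomotopy.eq_2, boundary_cone]
    simp only [map_sub, boundary_act_alt, act_of_id]
    rw [← act_act _ (boundary (n + 1)), ih]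
    simp only [map_sub, LinearMap.sub_apply, act_id, act_act, boundary_act_boundary, map_zero,
      sub_zero, sub_self]

theorem boundary_altHomotopy_apply (K : SymmetricSet.{u}) {n : ℕ} (c : K.Chain (n + 1))
    (hc : K.act (boundary n) c = 0) :
    K.act (boundary (n + 1)) (K.act (altHomotopy (n + 1)) c) = K.act (alt (n + 1)) c - c := by
  rw [← act_act, boundary_altHomotopy_succ, map_sub, map_sub, LinearMap.sub_apply,
    LinearMap.sub_apply, act_id, act_act, hc, map_zero, sub_zero]

/-- The antisymmetrized chain is again a cycle, and its boundary is `n + 2` times its zeroth face.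
Dividing by `n + 2` kills that face, and the others equal it up to sign. -/
theorem mapDomain_face_act_alt (K : SymmetricSet.{u}) {n : ℕ} (c : K.Chain (n + 1))
    (hc : K.act (boundary n) c = 0) (j : Fin (n + 2)) :
    (K.act (alt (n + 1)) c).mapDomain (K.map j.succAbove) = 0 := by
  have h2 : ((n : ℝ) + 2) ≠ 0 := by positivity
  have h : K.act (boundary n) (K.act (alt (n + 1)) c) = 0 := by
    rw [← act_act, boundary_act_alt, act_act, hc, map_zero]
  rw [← act_of, ← act_act]
  rw [← act_act] at h
  simp only [alt, map_smul, boundary_act_signedSum, face_act_signedSum, LinearMap.smul_apply] at h ⊢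
  rw [smul_comm, smul_eq_zero_iff_right h2] at h
  rw [smul_comm, h, smul_zero]

end SymmetricSet

/-! ### Estimates for the `ℓ¹`-norm -/

section AbsSum

variable {S T : Type*}

theorem Finsupp.sum_abs_add_le (c d : S →₀ ℝ) :
    ((c + d).sum fun _ a => |a|) ≤ (c.sum fun _ a => |a|) + d.sum fun _ a => |a| := by
  classical
  rw [Finsupp.sum_of_support_subset (c + d) Finsupp.support_add _ (by simp),
    Finsupp.sum_of_support_subset c Finset.subset_union_left _ (by simp),
    Finsupp.sum_of_support_subset d Finset.subset_union_right _ (by simp),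
    ← Finset.sum_add_distrib]
  exact Finset.sum_le_sum fun s _ => abs_add_le _ _

theorem Finsupp.sum_abs_finsetSum_le {ι : Type*} (t : Finset ι) (c : ι → S →₀ ℝ) :
    ((∑ i ∈ t, c i).sum fun _ a => |a|) ≤ ∑ i ∈ t, (c i).sum fun _ a => |a| :=
  Finset.le_sum_of_subadditive (fun c : S →₀ ℝ => c.sum fun _ a => |a|) (by simp)
    Finsupp.sum_abs_add_le t c

theorem Finsupp.sum_abs_smul (r : ℝ) (c : S →₀ ℝ) :
    ((r • c).sum fun _ a => |a|) = |r| * c.sum fun _ a => |a| := by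
  rw [Finsupp.sum_smul_index (by simp)]
  simp only [abs_mul, Finsupp.mul_sum]

theorem Finsupp.sum_abs_mapDomain_le (f : S → T) (c : S →₀ ℝ) :
    ((c.mapDomain f).sum fun _ a => |a|) ≤ c.sum fun _ a => |a| := by
  refine (Finsupp.sum_abs_finsetSum_le _ _).trans (Finset.sum_le_sum fun s _ => ?_)
  simp

theorem Finsupp.sum_abs_nonneg (c : S →₀ ℝ) : 0 ≤ c.sum fun _ a => |a| :=
  Finset.sum_nonneg fun _ _ => abs_nonneg _

end AbsSum

theorem SymmetricSet.sum_abs_act_alt_le (K : SymmetricSet.{u}) {n : ℕ} (c : K.Chain n) :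
    ((K.act (alt n) c).sum fun _ a => |a|) ≤ c.sum fun _ a => |a| := by
  have hf : (0 : ℝ) < (n + 1).factorial := by positivity
  simp only [alt, signedSum, map_smul, map_sum, LinearMap.smul_apply, LinearMap.sum_apply, act_of]
  rw [Finsupp.sum_abs_smul, abs_of_pos (inv_pos.2 hf), inv_mul_le_iff₀ hf]
  refine (Finsupp.sum_abs_finsetSum_le _ _).trans ?_
  refine (Finset.sum_le_card_nsmul _ _ (c.sum fun _ a => |a|) fun τ _ => ?_).trans_eq ?_
  · rw [Finsupp.sum_abs_smul, ← Int.cast_abs, Int.isUnit_iff_abs_eq.1 (Equiv.Perm.sign τ).isUnit,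
      Int.cast_one, one_mul]
    exact Finsupp.sum_abs_mapDomain_le _ _
  · rw [Finset.card_univ, Fintype.card_perm, Fintype.card_fin, nsmul_eq_mul]

/-! ### Points of `‖Hℝ‖_r(S₊)` and their chains -/

namespace SModule

/-- The finite set `T ⊆ S` with a base point, enumerated. -/
noncomputable def enumWithPoint {S : Type u} (T : Finset S) : Fin (T.card + 1) → Option S :=
  Fin.cons none fun i => some (T.equivFin.symm i)

theorem enumWithPoint_injective {S : Type u} (T : Finset S) :
    Function.Injective (enumWithPoint T) := by
  refine Fin.cons_injective_iff.2 ⟨by simp, fun i j h => ?_⟩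
  exact T.equivFin.symm.injective (Subtype.ext (Option.some.inj h))

theorem exists_enumWithPoint_eq {S : Type u} {T : Finset S} {s : S} (hs : s ∈ T) :
    ∃ i, enumWithPoint T i = some s :=
  ⟨(T.equivFin ⟨s, hs⟩).succ, by simp [enumWithPoint]⟩

/-- The chain underlying an element of `‖Hℝ‖_r(S₊)`. -/
noncomputable def normToFree (r : ℝ) (hr : 0 < r) (S : Type u)
    (x : ((normHR r hr).ext.obj (typeToPointed.obj S)).X) : S →₀ ℝ :=
  extToFree S (((extNatTrans (normHRIncl r hr)).app (typeToPointed.obj S)).toFun x)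

theorem sum_abs_normToFree_lt (r : ℝ) (hr : 0 < r) (S : Type u)
    (x : ((normHR r hr).ext.obj (typeToPointed.obj S)).X) :
    ((normToFree r hr S x).sum fun _ a => |a|) < r := by
  induction x using Quot.ind with
  | mk p =>
    -- Base-point entries are dropped and repeated simplices may cancel, so the chain's norm is at
    -- most that of the tuple.
    refine lt_of_le_of_lt ?_ p.coeff.2
    refine (Finsupp.sum_abs_finsetSum_le _ _).trans (Finset.sum_le_sum fun i _ => ?_)
    change ((Option.elim (α := S) (p.pt i.succ) 0
      (fun s => Finsupp.single s (p.coeff.1 i))).sum fun _ a => |a|) ≤ |p.coeff.1 i|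
    cases (p.pt i.succ : Option S) <;> simp

theorem normToFree_enum (r : ℝ) (hr : 0 < r) {S : Type u} (T : Finset S)
    (φ : {φ : Fin T.card → ℝ // ∑ i, |φ i| < r}) :
    normToFree r hr S (Quot.mk _ ⟨⟨T.card⟩, enumWithPoint T, rfl, φ⟩) =
      ∑ i, Finsupp.single (T.equivFin.symm i : S) (φ.1 i) :=
  rfl

/-- Enumerating the support without repetition gives a tuple with exactly the norm of `c`. -/
theorem exists_normToFree_eq (r : ℝ) (hr : 0 < r) {S : Type u} (c : S →₀ ℝ)
    (hc : (c.sum fun _ a => |a|) < r) : ∃ x, normToFree r hr S x = c := by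
  have hsum : ∑ i, |c (c.support.equivFin.symm i)| = c.sum fun _ a => |a| := by
    rw [Equiv.sum_comp c.support.equivFin.symm fun s => |c s|,
      Finset.sum_coe_sort c.support fun s => |c s|]
    rfl
  refine ⟨_, (normToFree_enum r hr c.support
    ⟨fun i => c (c.support.equivFin.symm i), hsum.trans_lt hc⟩).trans ?_⟩
  rw [Equiv.sum_comp c.support.equivFin.symm fun s => Finsupp.single (s : S) (c s),
    Finset.sum_coe_sort c.support fun s => Finsupp.single s (c s)]
  exact c.sum_single

/-- A representative may repeat simplices, so its tuple need not vanish. Pushed forward to its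
finite set of distinct simplices, the tuple becomes the coefficients of the chain, hence zero. -/
theorem eq_point_of_normToFree_eq_zero (r : ℝ) (hr : 0 < r) {S : Type u}
    (x : ((normHR r hr).ext.obj (typeToPointed.obj S)).X) (hx : normToFree r hr S x = 0) :
    x = ((normHR r hr).ext.obj (typeToPointed.obj S)).point := by
  classical
  induction x using Quot.ind with
  | mk p =>
    obtain ⟨k, pt, pt_zero, φ⟩ := p
    let q : Fin (k.card + 1) → Option S := pt
    let T : Finset S := Finset.eraseNone (Finset.univ.image q)
    have hq (i) : ∃ j, enumWithPoint T j = q i := by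
      cases h : q i with
      | none => exact ⟨0, rfl⟩
      | some s => exact exists_enumWithPoint_eq (by simp [T, ← h])
    choose f hf using hq
    have hf0 : f 0 = 0 := enumWithPoint_injective T ((hf 0).trans pt_zero)
    let g : k ⟶ (⟨T.card⟩ : GammaOp) := ⟨f, hf0⟩
    have hrel : (Quot.mk _ ⟨k, pt, pt_zero, φ⟩ : (normHR r hr).extObj (typeToPointed.obj S)) =
        Quot.mk _ ⟨⟨T.card⟩, enumWithPoint T, rfl, ((normHR r hr).toFunctor.map g).toFun φ⟩ := by
      have := Quot.sound (PreRel.mk (F := normHR r hr) (Y := typeToPointed.obj S) g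
        (enumWithPoint T) rfl φ)
      rw [← this]
      congr 2
      exact (funext hf).symm
    have hzero : ((normHR r hr).toFunctor.map g).toFun φ =
        ((normHR r hr).toFunctor.obj ⟨T.card⟩).point := by
      generalize ((normHR r hr).toFunctor.map g).toFun φ = ψ at hrel
      rw [hrel] at hx
      refine Subtype.ext (funext fun i => ?_)
      have h := DFunLike.congr_fun ((normToFree_enum r hr T ψ).symm.trans hx)
        (T.equivFin.symm i : S)
      rw [Finsupp.finsetSum_apply, Finset.sum_eq_single i] at h
      · exact Finsupp.single_eq_same.symm.trans h
      · intro j _ hji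
        refine Finsupp.single_eq_of_ne fun h => hji ?_
        exact (T.equivFin.symm.injective (Subtype.ext h)).symm
      · simp
    rw [hrel, hzero]
    -- The zero tuple on `T` comes from `0₊`, where the base point of the colimit is represented.
    let g0 : (⟨0⟩ : GammaOp) ⟶ (⟨T.card⟩ : GammaOp) := ⟨fun _ => 0, rfl⟩
    have h0 := Quot.sound (PreRel.mk (F := normHR r hr) (Y := typeToPointed.obj S) g0
      (enumWithPoint T) rfl ((normHR r hr).toFunctor.obj ⟨0⟩).point)
    rw [Pointed.Hom.map_point] at h0
    exact h0.symm

end SModule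

/-! ### Singular cycles with vanishing faces -/

namespace SingularHomology

open SModule PointedSimplicial

/-- The singular simplices of a space, as a symmetric set. -/
noncomputable def singularSet (X : TopCat.{u}) : SymmetricSet.{u} where
  obj n := (TopCat.toSSet.obj X).obj (op (.mk n))
  map {m n} f σ := (X.toSSetObjEquiv (op (.mk m))).symm
    ((X.toSSetObjEquiv (op (.mk n)) σ).comp ⟨stdSimplex.map f, stdSimplex.continuous_map f⟩)
  map_id σ := by
    rw [Equiv.symm_apply_eq]
    ext t
    simp [stdSimplex.map_id_apply]
  map_comp f g σ := by
    rw [Equiv.apply_symm_apply]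
    congr 1
    ext t
    simp [stdSimplex.map_comp_apply]

theorem singularSet_map_succAbove (X : TopCat.{u}) {n : ℕ} (j : Fin (n + 2)) :
    (singularSet X).map j.succAbove = SimplicialObject.δ (TopCat.toSSet.obj X) j := by
  funext σ
  refine (Equiv.symm_apply_eq _).2 ?_
  ext t
  exact (TopCat.toSSetObjEquiv_δ_apply σ j t).symm

theorem d_toChain_eq_act (X : TopCat.{u}) {n : ℕ} (c : (singularSet X).Chain (n + 1)) :
    (chains (TopCat.toSSet.obj X)).d (n + 1) n (toChain _ (n + 1) c) =
      toChain _ n ((singularSet X).act (SymmetricSet.boundary n) c) := by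
  refine (d_toChain (TopCat.toSSet.obj X) n c).trans (congrArg (toChain _ n) ?_)
  rw [SymmetricSet.act_boundary]
  simp only [singularSet_map_succAbove]
  rfl

theorem homologyClass_surjective (K : SSet.{u}) (n : ℕ) (α : (chains K).homology n) :
    ∃ c hc, homologyClass K n c hc = α := by
  obtain ⟨z, rfl⟩ := (ModuleCat.epi_iff_surjective ((chains K).homologyπ n)).1 inferInstance α
  have hz (m : ℕ) : (chains K).d n m ((chains K).iCycles n z) = 0 := by
    rw [← ModuleCat.comp_apply, HomologicalComplex.iCycles_d]
    rfl
  refine ⟨(chains K).iCycles n z, hz, congrArg ((chains K).homologyπ n) ?_⟩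
  apply (ModuleCat.mono_iff_injective ((chains K).iCycles n)).1 inferInstance
  exact (chains K).i_cyclesMk _ _ _ _

/-- All faces of the chain vanish individually. -/
def HasZeroFaces (K : SSet.{u}) : (n : ℕ) → (K.obj (op (.mk n)) →₀ ℝ) → Prop
  -- As in `IsSpherical`, degree zero imposes no condition.
  | 0, _ => True
  | n + 1, c => ∀ j : Fin (n + 2), c.mapDomain (SimplicialObject.δ K j) = 0

theorem HasZeroFaces.isCycle {K : SSet.{u}} {n : ℕ} {c : K.obj (op (.mk n)) →₀ ℝ}
    (h : HasZeroFaces K n c) : IsCycle K n c := by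
  intro m
  by_cases hm : m + 1 = n
  · subst hm
    rw [d_toChain, Finset.sum_eq_zero fun j _ => by rw [h j, smul_zero]]
    rfl
  · rw [(chains K).shape n m hm]
    rfl

/-- Every singular cycle is homologous to its antisymmetrization, all of whose faces vanish. -/
theorem exists_hasZeroFaces (X : TopCat.{u}) (n : ℕ)
    (c : (TopCat.toSSet.obj X).obj (op (.mk n)) →₀ ℝ) (hc : IsCycle (TopCat.toSSet.obj X) n c) :
    ∃ (c' : (TopCat.toSSet.obj X).obj (op (.mk n)) →₀ ℝ)
      (hc' : HasZeroFaces (TopCat.toSSet.obj X) n c'),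
      homologyClass _ n c' hc'.isCycle = homologyClass _ n c hc ∧
        chainNorm c' ≤ chainNorm c := by
  cases n with
  | zero => exact ⟨c, trivial, rfl, le_rfl⟩
  | succ n =>
    have hd : (singularSet X).act (SymmetricSet.boundary n) c = 0 :=
      (d_toChain_eq_act X c).symm.trans (hc n)
    refine ⟨(singularSet X).act (SymmetricSet.alt (n + 1)) c, fun j => ?_, ?_,
      (singularSet X).sum_abs_act_alt_le c⟩
    · rw [← singularSet_map_succAbove]
      exact (singularSet X).mapDomain_face_act_alt c hd j
    · refine homologyClass_eq _ _ _ _ _ _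
        (toChain _ _ ((singularSet X).act (SymmetricSet.altHomotopy (n + 1)) c)) ?_
      exact (d_toChain_eq_act X _).trans
        (congrArg (toChain _ _) ((singularSet X).boundary_altHomotopy_apply c hd))

theorem chainNorm_nonneg {K : SSet.{u}} {n : ℕ} (c : K.obj (op (.mk n)) →₀ ℝ) : 0 ≤ chainNorm c :=
  c.sum_abs_nonneg

end SingularHomology

/-! ### Comparison of the two filtrations -/

open SingularHomology SModule PointedSimplicial

theorem SModule.normToFree_δ (K : SSet.{u}) (n : ℕ) (r : ℝ) (hr : 0 < r) (j : Fin (n + 2))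
    (x : (((normHR r hr).onSSet K).obj (op (.mk (n + 1)))).X) :
    normToFree r hr (K.obj (op (.mk n))) ((((normHR r hr).onSSet K).δ j).toFun x) =
      (normToFree r hr (K.obj (op (.mk (n + 1)))) x).mapDomain (SimplicialObject.δ K j) :=
  (congrArg (extToFree _) (naturality_δ (Functor.whiskerLeft K
    (Functor.whiskerLeft typeToPointed (extNatTrans (normHRIncl r hr)))) j x).symm).trans
    (extToFree_δ K n j _).symm

theorem SModule.isSpherical_of_hasZeroFaces (K : SSet.{u}) (n : ℕ) (r : ℝ) (hr : 0 < r)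
    (x : (((normHR r hr).onSSet K).obj (op (.mk n))).X)
    (h : HasZeroFaces K n (normToFree r hr _ x)) : IsSpherical ((normHR r hr).onSSet K) n x := by
  cases n with
  | zero => trivial
  | succ n =>
    intro j
    exact eq_point_of_normToFree_eq_zero r hr _ ((normToFree_δ K n r hr j x).trans (h j))

theorem SModule.mem_range_rho_iff (X : TopCat.{u}) (n : ℕ) (r : ℝ) (hr : 0 < r) (α : H X n) :
    α ∈ Set.range (rho X n r hr) ↔ l1Seminorm X n α < r := by
  constructor
  · rintro ⟨x, rfl⟩
    induction x using Quot.ind with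
    | mk x =>
      refine lt_of_le_of_lt (csInf_le ⟨0, ?_⟩ ⟨normToFree r hr _ x.1, ?_, ?_, rfl⟩)
        (sum_abs_normToFree_lt r hr _ x.1)
      · rintro _ ⟨c, _, _, rfl⟩
        exact chainNorm_nonneg c
      · exact isCycle_of_isSpherical _ n _ (x.2.map (Functor.whiskerLeft _
          (Functor.whiskerLeft typeToPointed (extNatTrans (normHRIncl r hr)))))
      · rfl
  · intro h
    obtain ⟨c₀, hc₀, hα⟩ := homologyClass_surjective _ n α
    -- Some cycle lies strictly below `r`. The representative `c₀` is needed since the infimum of an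
    -- empty set would be `0` by convention.
    obtain ⟨_, ⟨c, hc, rfl, rfl⟩, hlt⟩ :=
      exists_lt_of_csInf_lt (by exact ⟨_, c₀, hc₀, hα, rfl⟩) h
    obtain ⟨c', hc', hclass, hle⟩ := exists_hasZeroFaces X n c hc
    obtain ⟨x, rfl⟩ := exists_normToFree_eq r hr c' (hle.trans_lt hlt)
    exact ⟨Quot.mk _ ⟨x, isSpherical_of_hasZeroFaces _ n r hr x hc'⟩, hclass⟩

theorem theorem1p1 (X : TopCat.{u}) (n : ℕ) (α : SingularHomology.H X n) :
    (∀ (r : ℝ) (hr : 0 < r),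
      SingularHomology.l1Seminorm X n α < r ↔ α ∈ Set.range (SModule.rho X n r hr)) ∧
    SModule.ccSeminorm X n α = SingularHomology.l1Seminorm X n α := by
  refine ⟨fun r hr => (mem_range_rho_iff X n r hr α).symm, ?_⟩
  have h0 : 0 ≤ l1Seminorm X n α := by
    refine Real.sInf_nonneg ?_
    rintro _ ⟨c, _, _, rfl⟩
    exact chainNorm_nonneg c
  -- Positivity of `r` is automatic on the ray, as the `ℓ¹`-semi-norm is nonnegative.
  have : {r : ℝ | ∃ hr : 0 < r, α ∈ Set.range (rho X n r hr)} = Set.Ioi (l1Seminorm X n α) := by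
    ext r
    simp only [mem_range_rho_iff, Set.mem_ofPred_eq, Set.mem_Ioi, exists_prop, and_iff_right_iff_imp]
    exact h0.trans_lt
  rw [ccSeminorm, this, csInf_Ioi]
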